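/- Let $k$ be an algebraically closed field of characteristic $p>2$, and let $m=sp+1$ with an integer $s\ge 0$. Let $\mathcal{X}$ be the nonsingular projective curve over $k$ given by the affine equation $y^2=x^m+1$, that is, with function field $K=k(x,y)$, where $x$ is transcendental over $k$ and $y^2=x^m+1$. Let $H^0(\mathcal{X},\Omega^1)\subseteq\Omega_{K/k}$ be the space of holomorphic differentials on $\mathcal{X}$, and let the $a$-number $a(\mathcal{X})$ be the dimension over $k$ of the space of exact holomorphic differentials $\{\omega\in H^0(\mathcal{X},\Omega^1) : \omega=dh \text{ for some } h\in K\}$. Then: 1. If $s=2k'+1$ with $k'\ge 0$, then $a(\mathcal{X})=\dfrac{(k'+1)(p-1)}{2}$. 2. If $s=2k'$ with $k'\ge 1$, then $a(\mathcal{X})=\dfrac{k'(p-1)}{2}$. Moreover, $a(\mathcal{X})$ equals the dimension over $k$ of the kernel of the Cartier operator $\mathscr{C}$ on $H^0(\mathcal{X},\Omega^1)$, where $\mathscr{C}\bigl((f_0^p+f_1^pt+\cdots+f_{p-1}^pt^{p-1})\,dt\bigr)=f_{p-1}\,dt$ for $f_0,\dots,f_{p-1}\in K$, and $t$ is any element of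 $K\setminus K^p$. -/

import Mathlib

open Polynomial KaehlerDifferential

/-- `K = k(x, y)` is the function field of the (nonsingular projective model of the) plane curve
`y ^ 2 = f(x)` over `k`: the function `x` is transcendental over `k`, the functions `x` and `y`
satisfy the equation of the curve, and they generate `K` as a field over `k`. -/
structure IsFunctionFieldOfSqEq {k K : Type*} [Field k] [Field K] [Algebra k K]
    (f : k[X]) (x y : K) : Prop where
  transcendental : Transcendental k x
  equation : y ^ 2 = aeval x f
  adjoin_eq_top : IntermediateField.adjoin k {x, y} = ⊤

/-- Such a function field exists for every `f`. -/
theorem exists_isFunctionFieldOfSqEq {k : Type*} [Field k] (f : k[X]) :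
    ∃ (K : IntermediateField k (AlgebraicClosure (RatFunc k))) (x y : K),
      IsFunctionFieldOfSqEq f x y := by
  let L := AlgebraicClosure (RatFunc k)
  let x : L := algebraMap (RatFunc k) L RatFunc.X
  obtain ⟨y, hy⟩ := IsAlgClosed.exists_pow_nat_eq (aeval x f) (n := 2) (by norm_num)
  have hx : Transcendental k x :=
    (transcendental_algebraMap_iff (algebraMap (RatFunc k) L).injective).mpr
      RatFunc.transcendental_X
  let E := IntermediateField.adjoin k ({x, y} : Set L)
  have hxE : x ∈ E := IntermediateField.subset_adjoin k _ (by simp)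
  have hyE : y ∈ E := IntermediateField.subset_adjoin k _ (by simp)
  refine ⟨E, ⟨x, hxE⟩, ⟨y, hyE⟩, ?_, ?_, ?_⟩
  · intro h
    exact hx (h.algebraMap (A := L))
  · apply Subtype.ext
    have : ((aeval (⟨x, hxE⟩ : E) f : E) : L) = aeval x f :=
      (aeval_algebraMap_apply L (⟨x, hxE⟩ : E) f).symm
    rw [this, ← hy]
    rfl
  · apply IntermediateField.map_injective E.val
    rw [IntermediateField.adjoin_map, ← AlgHom.fieldRange_eq_map, IntermediateField.fieldRange_val]
    simp [Set.image_pair, E]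

section Differentials

variable (k K : Type*) [Field k] [Field K] [Algebra k K]

/-- The differential `ω` of `K / k` is regular at the place with valuation ring `O`: it lies in the
`O`-submodule `∑ O dg`, `g ∈ O`, of `Ω[K⁄k]` (the image of `Ω[O⁄k]`). When `O` is the local ring of
a point of a nonsingular curve over an algebraically closed field and `t` is a uniformizer, this
submodule is `O dt`, so that regularity means that `ω` has nonnegative order at that point. -/
noncomputable def IsRegularAt (O : ValuationSubring K) (ω : Ω[K⁄k]) : Prop :=
  ω ∈ AddSubgroup.closure {η : Ω[K⁄k] | ∃ a ∈ O, ∃ g ∈ O, η = a • D k K g}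

/-- The space `H⁰(𝒳, Ω¹)` of holomorphic differentials of the nonsingular projective curve `𝒳` with
function field `K` over `k`: the differentials of `K / k` that are regular at every place, that is,
at every valuation ring of `K` containing `k` (the improper one, `K` itself, imposes nothing). -/
noncomputable def holomorphicDifferentials : Submodule k Ω[K⁄k] where
  carrier := {ω | ∀ O : ValuationSubring K, (∀ c : k, algebraMap k K c ∈ O) → IsRegularAt k K O ω}
  zero_mem' := fun _ _ => AddSubgroup.zero_mem _
  add_mem' := fun hω hη O hO => AddSubgroup.add_mem _ (hω O hO) (hη O hO)
  smul_mem' := by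
    intro c ω hω O hO
    refine AddSubgroup.closure_induction (p := fun η _ => IsRegularAt k K O (c • η))
      ?_ ?_ ?_ ?_ (hω O hO)
    · rintro _ ⟨a, ha, g, hg, rfl⟩
      refine AddSubgroup.subset_closure ⟨c • a, ?_, g, hg, by rw [smul_assoc]⟩
      rw [Algebra.smul_def]
      exact O.mul_mem _ _ (hO c) ha
    · rw [smul_zero]
      exact AddSubgroup.zero_mem _
    · intro η η' _ _ h h'
      rw [smul_add]
      exact AddSubgroup.add_mem _ h h'
    · intro η _ h
      rw [smul_neg]
      exact AddSubgroup.neg_mem _ h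

/-- The space of exact holomorphic differentials: the holomorphic differentials of the form `dh`
with `h ∈ K`. -/
noncomputable def exactHolomorphicDifferentials : Submodule k Ω[K⁄k] :=
  holomorphicDifferentials k K ⊓ LinearMap.range (D k K).toLinearMap

/-- The `a`-number of the nonsingular projective curve with function field `K` over `k`: the
dimension of the space of exact holomorphic differentials. -/
noncomputable def aNumber : ℕ :=
  Module.finrank k (exactHolomorphicDifferentials k K)

variable {K}

/-- The Cartier operator, as the relation `𝒞(ω) = η`, computed with the separating variable `t`:
if `ω = (f₀ ^ p + f₁ ^ p t + ⋯ + f_{p-1} ^ p t ^ (p-1)) dt`, then `𝒞(ω) = f_{p-1} dt`. -/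
noncomputable def CartierEq (p : ℕ) (t : K) (ω η : Ω[K⁄k]) : Prop :=
  ∃ f : ℕ → K, ω = (∑ i ∈ Finset.range p, f i ^ p * t ^ i) • D k K t ∧ η = f (p - 1) • D k K t

/-- The kernel of the Cartier operator on the space of holomorphic differentials. -/
noncomputable def cartierKernel [IsAlgClosed k] (p : ℕ) [Fact p.Prime] [CharP k p] (t : K) :
    Submodule k Ω[K⁄k] where
  carrier := {ω | ω ∈ holomorphicDifferentials k K ∧ CartierEq k p t ω 0}
  zero_mem' := ⟨Submodule.zero_mem _, 0, by simp [(Fact.out : p.Prime).ne_zero], by simp⟩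
  add_mem' := by
    rintro _ _ ⟨hω, f, rfl, hf⟩ ⟨hη, g, rfl, hg⟩
    have : CharP K p := charP_of_injective_algebraMap (algebraMap k K).injective p
    refine ⟨Submodule.add_mem _ hω hη, f + g, ?_, ?_⟩
    · rw [← add_smul, ← Finset.sum_add_distrib]
      simp only [Pi.add_apply, add_pow_char, add_mul]
    · rw [Pi.add_apply, add_smul, ← hf, ← hg, add_zero]
  smul_mem' := by
    rintro c _ ⟨hω, f, rfl, hf⟩
    obtain ⟨b, rfl⟩ := IsAlgClosed.exists_pow_nat_eq c (Fact.out : p.Prime).pos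
    refine ⟨Submodule.smul_mem _ _ hω, fun i => b • f i, ?_, ?_⟩
    · rw [← smul_assoc, Finset.smul_sum]
      simp only [_root_.smul_pow, smul_mul_assoc]
    · rw [smul_assoc, ← hf, smul_zero]

end Differentials

/-! Put `η = dx/y` and `p = 2r + 1`. A differential `h η` regular over the affine line has `h` in
the integral closure `k[x] + k[x] y` of `k[x]`. In the chart at infinity, `u = 1/x` and `v = y/x ^
n` satisfy `v ^ 2 = u ^ e (u ^ m + 1)` with `m + e = 2n`, `e ≤ 1`. Comparing the two charts leaves
exactly `h = P(x)` with `deg P < g = n - 1`.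

Since `y⁻¹ = y ^ (-p) (x ^ m + 1) ^ r` and `p`-th powers are constants for `D`, `P(x) η` is exact
iff `P(x) (x ^ m + 1) ^ r dx` is. A polynomial differential in `x` is exact iff no exponent `≡ -1`
mod `p` occurs in it. As `m ≡ 1` mod `p`, the monomial `x ^ i` of `P` produces the exponents `i + m
c ≡ i + c` for `0 ≤ c ≤ r`, and these avoid `-1` iff `i % p < r`. Because `deg P < m`, exponents
coming from different `i` never collide, so the condition can be tested monomial by monomial. The
`a`-number is therefore the number of `i < g` with `i % p < r`, where `g` is `j p + r` for `s = 2j +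
1` and `j p` for `s = 2j`.

For the Cartier operator, `1, t, …, t ^ (p-1)` is a basis of `K` over `K ^ p` whenever `t ∉ K ^ p`.
Each `f ^ p t ^ i dt` with `i < p - 1` can be integrated, and `t ^ (p-1) dt` never arises from
differentiation, so the kernel is the space of exact differentials. -/

/-! ### Regularity at the places of a Dedekind domain -/

section Dedekind

/-- The localization of a Dedekind domain at a height one prime, as a valuation ring of its
fraction field. -/
theorem exists_valuationSubring_eq_localization {R K : Type*} [CommRing R] [IsDedekindDomain R]
    [Field K] [Algebra R K] [IsFractionRing R K] (v : IsDedekindDomain.HeightOneSpectrum R) :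
    ∃ O : ValuationSubring K, ∀ z : K, z ∈ O ↔
      z ∈ Localization.subalgebra.ofField K _ v.asIdeal.primeCompl_le_nonZeroDivisors := by
  have hloc := Localization.subalgebra.isLocalization_ofField K _
    v.asIdeal.primeCompl_le_nonZeroDivisors
  have hfrac := Localization.subalgebra.isFractionRing_ofField K _
    v.asIdeal.primeCompl_le_nonZeroDivisors
  set B := Localization.subalgebra.ofField K _ v.asIdeal.primeCompl_le_nonZeroDivisors
  have : IsDiscreteValuationRing B :=
    IsLocalization.AtPrime.isDiscreteValuationRing_of_dedekind_domain R v.ne_bot B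
  refine ⟨⟨B.toSubring, fun z => ?_⟩, fun z => Iff.rfl⟩
  rcases ValuationRing.isInteger_or_isInteger B z with ⟨a, ha⟩ | ⟨a, ha⟩
  · exact Or.inl (ha ▸ a.2)
  · exact Or.inr (ha ▸ a.2)

theorem mem_ofField_iff {R K : Type*} [CommRing R] [IsDomain R]
    [Field K] [Algebra R K] [IsFractionRing R K] (S : Submonoid R) (hS : S ≤ nonZeroDivisors R)
    (z : K) : z ∈ Localization.subalgebra.ofField K S hS ↔
      ∃ a s, s ∈ S ∧ z = algebraMap R K a / algebraMap R K s := by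
  constructor
  · rintro ⟨a, s, hs, h⟩
    exact ⟨a, s, hs, by rw [div_eq_mul_inv]; exact h⟩
  · rintro ⟨a, s, hs, h⟩
    exact ⟨a, s, hs, by rw [← div_eq_mul_inv]; exact h⟩

/-- If `η ≠ 0` and `D` maps the Dedekind domain `R` into `R η`, then a differential `h η` that is
regular at all places has `h ∈ R`. -/
theorem mem_range_algebraMap_of_isRegularAt {k R K : Type*} [Field k] [CommRing R]
    [IsDedekindDomain R] [Field K] [Algebra k K] [Algebra R K] [IsFractionRing R K]
    (hk : ∀ c : k, algebraMap k K c ∈ (algebraMap R K).range)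
    {η : Ω[K⁄k]} (hη : η ≠ 0) (hD : ∀ r : R, ∃ r' : R, D k K (algebraMap R K r) =
      algebraMap R K r' • η) {h : K}
    (hreg : ∀ O : ValuationSubring K, (∀ c : k, algebraMap k K c ∈ O) → IsRegularAt k K O (h • η)) :
    h ∈ (algebraMap R K).range := by
  -- A Dedekind domain is the intersection of its localizations at height one primes; at each of
  -- them the quotient rule puts every regular differential in `O η`.
  have key : h ∈ (⊥ : Subalgebra R K) := by
    rw [← IsDedekindDomain.HeightOneSpectrum.iInf_localization_eq_bot R K, Algebra.mem_iInf]
    intro v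
    obtain ⟨O, hO⟩ := exists_valuationSubring_eq_localization (K := K) v
    rw [← hO]
    have hRO : ∀ r : R, algebraMap R K r ∈ O := fun r => (hO _).2 (Subalgebra.algebraMap_mem _ r)
    have hmem : ∀ ω : Ω[K⁄k], IsRegularAt k K O ω → ∃ a ∈ O, ω = a • η := by
      intro ω hω
      refine AddSubgroup.closure_induction (p := fun ω _ => ∃ a ∈ O, ω = a • η) ?_ ?_ ?_ ?_ hω
      · rintro _ ⟨a, ha, g, hg, rfl⟩
        obtain ⟨n, s, hs, rfl⟩ := (mem_ofField_iff _ _ _).1 ((hO g).1 hg)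
        obtain ⟨n', hn'⟩ := hD n
        obtain ⟨s', hs'⟩ := hD s
        have hs0 : algebraMap R K s ≠ 0 := by
          rw [Ne, FaithfulSMul.algebraMap_eq_zero_iff]
          rintro rfl
          exact hs (zero_mem _)
        have hsO : (algebraMap R K s)⁻¹ ∈ O := by
          rw [hO, mem_ofField_iff]
          exact ⟨1, s, hs, by simp⟩
        refine ⟨a * ((algebraMap R K s)⁻¹ * (algebraMap R K s)⁻¹ *
          (algebraMap R K s * algebraMap R K n' - algebraMap R K n * algebraMap R K s')),
          O.mul_mem _ _ ha (O.mul_mem _ _ (O.mul_mem _ _ hsO hsO)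
            (O.sub_mem (O.mul_mem _ _ (hRO _) (hRO _)) (O.mul_mem _ _ (hRO _) (hRO _)))), ?_⟩
        rw [Derivation.leibniz_div, hn', hs', inv_pow, pow_two, mul_inv]
        simp only [mul_smul, sub_smul]
      · exact ⟨0, O.zero_mem, by simp⟩
      · rintro _ _ _ _ ⟨a, ha, rfl⟩ ⟨b, hb, rfl⟩
        exact ⟨a + b, O.add_mem _ _ ha hb, by rw [add_smul]⟩
      · rintro _ _ ⟨a, ha, rfl⟩
        exact ⟨-a, O.neg_mem _ ha, by rw [neg_smul]⟩
    obtain ⟨a, ha, h'⟩ := hmem _ (hreg O fun c => by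
      obtain ⟨r, hr⟩ := hk c
      exact hr ▸ hRO r)
    rwa [smul_left_injective K hη h']
  simpa [Algebra.mem_bot] using key

end Dedekind

/-! ### The quadratic extension of `k(x)` given by `y ^ 2 = F` -/

section Quadratic

theorem isIntegral_of_sq_eq {k K : Type*} [Field k] [Field K] [Algebra k[X] K] {F : k[X]} {y : K}
    (hy : y ^ 2 = algebraMap k[X] K F) : IsIntegral k[X] y :=
  ⟨X ^ 2 - C F, monic_X_pow_sub_C F two_ne_zero, by simp [hy]⟩

theorem isIntegral_of_sq_eq' {k L K : Type*} [Field k] [Field L] [Field K] [Algebra k[X] L]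
    [Algebra L K] [Algebra k[X] K] [IsScalarTower k[X] L K] {F : k[X]} {y : K}
    (hy : y ^ 2 = algebraMap k[X] K F) : IsIntegral L y :=
  (isIntegral_of_sq_eq hy).tower_top

variable {k L K : Type*} [Field k] [Field L] [Field K] [Algebra k[X] L]
  [Algebra L K] [Algebra k[X] K] [IsScalarTower k[X] L K] {F : k[X]} {y : K}

theorem exists_eq_add_mul_of_sq_eq (hy : y ^ 2 = algebraMap k[X] K F)
    (htop : IntermediateField.adjoin L {y} = ⊤) (z : K) :
    ∃ a b : L, z = algebraMap L K a + algebraMap L K b * y := by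
  have hz : z ∈ Algebra.adjoin L {y} := by
    have : z ∈ (IntermediateField.adjoin L {y}).toSubalgebra := by
      rw [htop]; trivial
    rwa [IntermediateField.adjoin_simple_toSubalgebra_of_isAlgebraic
      (isIntegral_of_sq_eq' hy).isAlgebraic] at this
  induction hz using Algebra.adjoin_induction with
  | mem z hz => exact ⟨0, 1, by simpa using hz⟩
  | algebraMap r => exact ⟨r, 0, by simp⟩
  | add z w _ _ h1 h2 =>
    obtain ⟨a, b, rfl⟩ := h1
    obtain ⟨c, d, rfl⟩ := h2
    exact ⟨a + c, b + d, by simp only [map_add]; ring⟩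
  | mul z w _ _ h1 h2 =>
    obtain ⟨a, b, rfl⟩ := h1
    obtain ⟨c, d, rfl⟩ := h2
    refine ⟨a * c + b * d * algebraMap k[X] L F, a * d + b * c, ?_⟩
    simp only [map_add, map_mul, ← IsScalarTower.algebraMap_apply, ← hy]
    ring

variable [IsFractionRing k[X] L]

/-- A square root of `F` in `k(x)` would be integral over `k[x]`, hence a polynomial, which a
squarefree nonconstant `F` excludes. -/
theorem irreducible_X_sq_sub_C (hF : Squarefree F) (hdeg : 0 < F.natDegree) :
    Irreducible (X ^ 2 - C (algebraMap k[X] L F) : L[X]) := by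
  refine X_pow_sub_C_irreducible_of_prime Nat.prime_two fun b hb => ?_
  have hint : IsIntegral k[X] b :=
    ⟨X ^ 2 - C F, monic_X_pow_sub_C F two_ne_zero, by simp [hb]⟩
  obtain ⟨P, rfl⟩ := IsIntegrallyClosed.isIntegral_iff.1 hint
  rw [← map_pow] at hb
  have hPF : P ^ 2 = F := IsFractionRing.injective k[X] L hb
  have hu : IsUnit P := hF P ⟨1, by rw [← hPF]; ring⟩
  rw [← hPF, natDegree_pow, natDegree_eq_zero_of_isUnit hu] at hdeg
  simp at hdeg

theorem minpoly_eq_of_sq_eq (hF : Squarefree F) (hdeg : 0 < F.natDegree)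
    (hy : y ^ 2 = algebraMap k[X] K F) :
    minpoly L y = X ^ 2 - C (algebraMap k[X] L F) :=
  (minpoly.eq_of_irreducible_of_monic (irreducible_X_sq_sub_C hF hdeg)
    (by simp [hy, ← IsScalarTower.algebraMap_apply]) (monic_X_pow_sub_C _ two_ne_zero)).symm

theorem finrank_eq_two_of_sq_eq (hF : Squarefree F) (hdeg : 0 < F.natDegree)
    (hy : y ^ 2 = algebraMap k[X] K F) (htop : IntermediateField.adjoin L {y} = ⊤) :
    Module.finrank L K = 2 := by
  rw [← IntermediateField.finrank_top', ← htop,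
    IntermediateField.adjoin.finrank (isIntegral_of_sq_eq' hy), minpoly_eq_of_sq_eq hF hdeg hy,
    natDegree_X_pow_sub_C]

theorem isSeparable_of_sq_eq (h2 : (2 : k) ≠ 0) (hF : Squarefree F) (hdeg : 0 < F.natDegree)
    (hy : y ^ 2 = algebraMap k[X] K F) (htop : IntermediateField.adjoin L {y} = ⊤) :
    Algebra.IsSeparable L K := by
  have hsep : IsSeparable L y := by
    rw [IsSeparable, minpoly_eq_of_sq_eq hF hdeg hy]
    refine separable_X_pow_sub_C _ ?_ ?_
    · have : ((2 : k[X])) ≠ 0 := by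
        rw [← C_ofNat, Ne, C_eq_zero]; exact h2
      have h := (IsFractionRing.injective k[X] L).ne this
      rw [map_ofNat, map_zero] at h
      exact_mod_cast h
    · rw [Ne, FaithfulSMul.algebraMap_eq_zero_iff]
      exact hF.ne_zero
  have := (IntermediateField.isSeparable_adjoin_simple_iff_isSeparable L K).2 hsep
  rw [htop] at this
  exact Algebra.IsSeparable.of_algHom L _ (IntermediateField.topEquiv (F := L) (E := K)).symm.toAlgHom

/-- The integral closure of `k[x]` in the function field of `y ^ 2 = F(x)`, with `F` squarefree,
is `k[x] + k[x] y`. -/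
theorem exists_eq_add_mul_of_isIntegral (h2 : (2 : k) ≠ 0) (hF : Squarefree F)
    (hdeg : 0 < F.natDegree)
    (hy : y ^ 2 = algebraMap k[X] K F) (htop : IntermediateField.adjoin L {y} = ⊤) {z : K}
    (hz : IsIntegral k[X] z) :
    ∃ A B : k[X], z = algebraMap k[X] K A + algebraMap k[X] K B * y := by
  have hfr := finrank_eq_two_of_sq_eq hF hdeg hy htop
  have : FiniteDimensional L K := Module.finite_of_finrank_pos (by omega)
  obtain ⟨a, b, rfl⟩ := exists_eq_add_mul_of_sq_eq hy htop z
  have h2X : (C (2⁻¹ : k)) * 2 = 1 := by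
    rw [← C_ofNat, ← C_mul, inv_mul_cancel₀ h2, C_1]
  have htry : Algebra.trace L K y = 0 := by
    rw [trace_eq_finrank_mul_minpoly_nextCoeff, minpoly_eq_of_sq_eq hF hdeg hy, nextCoeff]
    simp [coeff_X_pow]
  -- The trace of `a + b y` is `2a`; as `2` is invertible, `a` is a polynomial.
  have htr := Algebra.isIntegral_trace (L := L) hz
  rw [map_add, Algebra.trace_algebraMap, hfr, ← Algebra.smul_def, map_smul, htry, smul_zero,
    add_zero, IsIntegrallyClosed.isIntegral_iff] at htr
  obtain ⟨A, hA⟩ := htr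
  have ha : a = algebraMap k[X] L (C (2⁻¹ : k) * A) := by
    rw [map_mul, hA, two_smul, ← two_mul, ← mul_assoc, ← map_ofNat (algebraMap k[X] L) 2,
      ← map_mul, h2X, map_one, one_mul]
  subst ha
  rw [← IsScalarTower.algebraMap_apply] at hz
  have hby : IsIntegral k[X] (algebraMap L K b * y) := by
    simpa using hz.sub (isIntegral_algebraMap (x := C (2⁻¹ : k) * A))
  -- Now `b y` is integral, so `b ^ 2 F` is a polynomial: the square of the denominator of `b`
  -- divides the squarefree `F`, and that denominator is a unit.
  have hbF : IsIntegral k[X] (b ^ 2 * algebraMap k[X] L F) := by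
    rw [← isIntegral_algebraMap_iff (FaithfulSMul.algebraMap_injective L K)]
    convert hby.pow 2 using 1
    rw [mul_pow, hy, map_mul, map_pow, ← IsScalarTower.algebraMap_apply]
  obtain ⟨P, hP⟩ := IsIntegrallyClosed.isIntegral_iff.1 hbF
  obtain ⟨c, d, hcop, rfl⟩ := IsFractionRing.exists_reduced_fraction (A := k[X]) b
  have hd0 : algebraMap k[X] L d ≠ 0 := by
    rw [Ne, FaithfulSMul.algebraMap_eq_zero_iff]
    exact nonZeroDivisors.ne_zero d.2
  have hcd : (d : k[X]) ^ 2 * P = c ^ 2 * F := by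
    apply IsFractionRing.injective k[X] L
    rw [map_mul, hP, IsFractionRing.mk'_eq_div, map_mul, map_pow, map_pow]
    field_simp
  have hdF : (d : k[X]) * d ∣ F := by
    rw [← pow_two]
    exact (IsRelPrime.pow hcop.symm).dvd_of_dvd_mul_left ⟨P, hcd.symm⟩
  obtain ⟨e, he⟩ := (hF _ hdF).exists_right_inv
  refine ⟨C (2⁻¹ : k) * A, c * e, ?_⟩
  have hce : IsLocalization.mk' L c d = algebraMap k[X] L (c * e) := by
    rw [IsFractionRing.mk'_eq_div, div_eq_iff hd0, ← map_mul, mul_assoc, mul_comm e, he, mul_one]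
  rw [hce, ← IsScalarTower.algebraMap_apply, ← IsScalarTower.algebraMap_apply]

end Quadratic

/-! ### The differential `dx` and the affine part of the curve -/

section FunctionField

-- Formal étaleness gives `Ω[K⁄k] = K ⊗ Ω[k[X]⁄k]`, and `Ω[k[X]⁄k]` is free on `dX`.
open TensorProduct in
theorem D_algebraMap_X_ne_zero {k K : Type*} [Field k] [Field K] [Algebra k K] [Algebra k[X] K]
    [IsScalarTower k k[X] K] [Algebra.FormallyEtale k[X] K] :
    D k K (algebraMap k[X] K X) ≠ 0 := by
  intro h
  have h1 := KaehlerDifferential.tensorKaehlerEquivOfFormallyEtale_symm_D_algebraMap k k[X] K X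
  rw [h, map_zero] at h1
  have h2 := congrArg (LinearMap.lTensor K (polynomialEquiv k).toLinearMap) h1.symm
  have h3 := congrArg (TensorProduct.rid k[X] K) h2
  simp at h3

variable {k K : Type*} [Field k] [Field K] [Algebra k K] {F : k[X]} {x y : K}

theorem IntermediateField.adjoin_singleton_eq_top_of_algebraMap_eq_aeval {L : Type*} [Field L]
    [Algebra k[X] L] [Algebra k[X] K] [Algebra L K] [IsScalarTower k[X] L K]
    (hadj : IntermediateField.adjoin k {x, y} = ⊤)
    (halg : ∀ P : k[X], algebraMap k[X] K P = aeval x P) :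
    IntermediateField.adjoin L {y} = ⊤ := by
  rw [eq_top_iff]
  intro z _
  have hmem : ∀ P : k[X], aeval x P ∈ IntermediateField.adjoin L {y} := fun P => by
    rw [← halg, IsScalarTower.algebraMap_apply k[X] L K]
    exact IntermediateField.algebraMap_mem _ _
  have hz : z ∈ IntermediateField.adjoin k {x, y} := hadj ▸ IntermediateField.mem_top
  induction hz using IntermediateField.adjoin_induction with
  | mem z hz =>
    rcases hz with rfl | rfl
    · simpa using hmem X
    · exact IntermediateField.mem_adjoin_simple_self L _
  | algebraMap c => simpa using hmem (C c)
  | add z w _ _ h1 h2 => exact add_mem (h1 trivial) (h2 trivial)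
  | inv z _ h => exact inv_mem (h trivial)
  | mul z w _ _ h1 h2 => exact mul_mem (h1 trivial) (h2 trivial)

/-- `dy = F'(x) / (2 y) dx`. -/
theorem D_eq_of_sq_eq (h2 : (2 : k) ≠ 0) (hy0 : y ≠ 0) (hy : y ^ 2 = aeval x F) :
    D k K y = (algebraMap k K 2⁻¹ * aeval x (derivative F)) • (y⁻¹ • D k K x) := by
  have h := congrArg (D k K) hy
  rw [Derivation.leibniz_pow, Derivation.map_aeval] at h
  have h2K : (2 : K) ≠ 0 := by
    have := (algebraMap k K).injective.ne h2
    rwa [map_ofNat, map_zero] at this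
  simp only [Nat.add_one_sub_one, pow_one] at h
  have : D k K y = (2 * y)⁻¹ • ((2 * y) • D k K y) := by
    rw [smul_smul, inv_mul_cancel₀ (mul_ne_zero h2K hy0), one_smul]
  rw [this, mul_smul, ofNat_smul_eq_nsmul, h, smul_smul, smul_smul, map_inv₀, map_ofNat]
  congr 1
  rw [mul_inv]
  ring

namespace IsFunctionFieldOfSqEq

theorem eq_zero_of_aeval_eq_zero (hK : IsFunctionFieldOfSqEq F x y) {P : k[X]}
    (hP : aeval x P = 0) : P = 0 := by
  by_contra h
  exact hK.transcendental ⟨P, h, hP⟩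

theorem y_ne_zero (hK : IsFunctionFieldOfSqEq F x y) (hF : F ≠ 0) : y ≠ 0 := by
  rintro rfl
  have := hK.equation
  rw [zero_pow two_ne_zero] at this
  exact hF (hK.eq_zero_of_aeval_eq_zero this.symm)

/-- `k[x] → k(x)` is a localization and `k(x) → K` is separable, so the composite is formally étale.
-/
theorem D_ne_zero (hK : IsFunctionFieldOfSqEq F x y) (h2 : (2 : k) ≠ 0) (hF : Squarefree F)
    (hdeg : 0 < F.natDegree) : D k K x ≠ 0 := by
  let : Algebra k[X] K := (aeval x).toAlgebra
  have halg : ∀ P : k[X], algebraMap k[X] K P = aeval x P := fun P => rfl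
  have : IsScalarTower k k[X] K := .of_algebraMap_eq fun c => by simp [halg]
  have : FaithfulSMul k[X] K := (faithfulSMul_iff_algebraMap_injective _ _).2
    (transcendental_iff_injective.1 hK.transcendental)
  let _ := FractionRing.liftAlgebra k[X] K
  have htop := IntermediateField.adjoin_singleton_eq_top_of_algebraMap_eq_aeval
    (L := FractionRing k[X]) hK.adjoin_eq_top halg
  have hy : y ^ 2 = algebraMap k[X] K F := hK.equation
  have := isSeparable_of_sq_eq h2 hF hdeg hy htop
  have := Algebra.FormallyEtale.of_isSeparable (FractionRing k[X]) K
  have := Algebra.FormallyEtale.of_isLocalization (Rₘ := FractionRing k[X])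
    (nonZeroDivisors k[X])
  have := Algebra.FormallyEtale.comp k[X] (FractionRing k[X]) K
  have h := D_algebraMap_X_ne_zero (k := k) (K := K)
  rwa [halg, aeval_X] at h

/-- `1` and `y` are linearly independent over `k[x]`. -/
theorem eq_zero_of_add_mul_eq_zero (hK : IsFunctionFieldOfSqEq F x y) (hF : Squarefree F)
    (hdeg : 0 < F.natDegree) {A B : k[X]} (h : aeval x A + aeval x B * y = 0) :
    A = 0 ∧ B = 0 := by
  have hB : B = 0 := by
    by_contra hB
    -- Multiply the relation by its conjugate `A - B y`; then `A / B` is a square root of `F` in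
    -- `k(x)`.
    have hABF : A ^ 2 = B ^ 2 * F := by
      rw [← sub_eq_zero]
      apply hK.eq_zero_of_aeval_eq_zero
      rw [map_sub, map_mul, map_pow, map_pow, ← hK.equation]
      linear_combination (aeval x A - aeval x B * y) * h
    have hirr := irreducible_X_sq_sub_C (L := FractionRing k[X]) hF hdeg
    have hB' : algebraMap k[X] (FractionRing k[X]) B ≠ 0 := by
      rwa [Ne, FaithfulSMul.algebraMap_eq_zero_iff]
    have hroot : (X ^ 2 - C (algebraMap k[X] (FractionRing k[X]) F)).IsRoot
        (algebraMap k[X] (FractionRing k[X]) A / algebraMap k[X] (FractionRing k[X]) B) := by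
      simp only [IsRoot, eval_sub, eval_pow, eval_X, eval_C]
      rw [div_pow, ← map_pow, hABF, map_mul, map_pow]
      field_simp
      ring
    have := degree_eq_one_of_irreducible_of_root hirr hroot
    rw [degree_X_pow_sub_C two_pos] at this
    exact absurd this (by decide)
  subst hB
  exact ⟨hK.eq_zero_of_aeval_eq_zero (by simpa using h), rfl⟩

/-- On the integral closure, `d(A + B y) = (A' y + B' F + B F' / 2) dx/y`, so `D` takes values in
its multiples of `dx/y` and the Dedekind criterion applies. -/
theorem exists_of_isRegularAt (hK : IsFunctionFieldOfSqEq F x y) (h2 : (2 : k) ≠ 0)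
    (hF : Squarefree F) (hdeg : 0 < F.natDegree) {h : K}
    (hreg : h • (y⁻¹ • D k K x) ∈ holomorphicDifferentials k K) :
    ∃ A B : k[X], h = aeval x A + aeval x B * y := by
  have hDx := hK.D_ne_zero h2 hF hdeg
  have hy0 := hK.y_ne_zero hF.ne_zero
  let : Algebra k[X] K := (aeval x).toAlgebra
  have halg : ∀ P : k[X], algebraMap k[X] K P = aeval x P := fun P => rfl
  have : IsScalarTower k k[X] K := .of_algebraMap_eq fun c => by simp [halg]
  have : FaithfulSMul k[X] K := (faithfulSMul_iff_algebraMap_injective _ _).2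
    (transcendental_iff_injective.1 hK.transcendental)
  let _ := FractionRing.liftAlgebra k[X] K
  have htop := IntermediateField.adjoin_singleton_eq_top_of_algebraMap_eq_aeval
    (L := FractionRing k[X]) hK.adjoin_eq_top halg
  have hy : y ^ 2 = algebraMap k[X] K F := hK.equation
  have := isSeparable_of_sq_eq h2 hF hdeg hy htop
  have hfr := finrank_eq_two_of_sq_eq hF hdeg hy htop
  have : FiniteDimensional (FractionRing k[X]) K := Module.finite_of_finrank_pos (by omega)
  have := integralClosure.isDedekindDomain k[X] (FractionRing k[X]) K
  have := integralClosure.isFractionRing_of_finite_extension (A := k[X]) (FractionRing k[X]) K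
  have hmem : h ∈ (algebraMap (integralClosure k[X] K) K).range := by
    refine mem_range_algebraMap_of_isRegularAt (fun c => ?_) (η := y⁻¹ • D k K x)
      (smul_ne_zero (inv_ne_zero hy0) hDx) ?_ hreg
    · exact ⟨algebraMap k[X] _ (C c), by
        rw [← IsScalarTower.algebraMap_apply, halg, aeval_C]⟩
    · rintro ⟨r, hr⟩
      obtain ⟨A, B, rfl⟩ := exists_eq_add_mul_of_isIntegral h2 hF hdeg hy htop hr
      have hyint : IsIntegral k[X] y := isIntegral_of_sq_eq hy
      refine ⟨⟨algebraMap k[X] K (derivative A) * y +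
        algebraMap k[X] K (derivative B * F + C 2⁻¹ * B * derivative F),
        (isIntegral_algebraMap.mul hyint).add isIntegral_algebraMap⟩, ?_⟩
      change D k K (aeval x A + aeval x B * y) = (aeval x (derivative A) * y +
        aeval x (derivative B * F + C 2⁻¹ * B * derivative F)) • (y⁻¹ • D k K x)
      rw [map_add, Derivation.leibniz, Derivation.map_aeval, Derivation.map_aeval,
        D_eq_of_sq_eq h2 hy0 hK.equation]
      simp only [smul_smul, ← add_smul]
      congr 1
      simp only [map_add, map_mul, aeval_C, ← hK.equation]
      field_simp
      ring
  obtain ⟨⟨r, hr⟩, rfl⟩ := hmem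
  obtain ⟨A, B, rfl⟩ := exists_eq_add_mul_of_isIntegral h2 hF hdeg hy htop hr
  exact ⟨A, B, rfl⟩

end IsFunctionFieldOfSqEq

end FunctionField

/-! ### Regularity of `dx/y` where `x` is finite -/

section Regular

variable {k K : Type*} [Field k] [Field K] [Algebra k K] {F : k[X]} {x y : K}

theorem ValuationSubring.aeval_mem (O : ValuationSubring K) (hO : ∀ c : k, algebraMap k K c ∈ O)
    (hx : x ∈ O) (P : k[X]) : aeval x P ∈ O := by
  rw [aeval_eq_sum_range]
  refine O.toSubring.sum_mem fun i _ => ?_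
  rw [Algebra.smul_def]
  exact O.mul_mem _ _ (hO _) (O.toSubring.pow_mem hx i)

theorem ValuationSubring.mem_of_sq_mem (O : ValuationSubring K) (h : y ^ 2 ∈ O) : y ∈ O := by
  rcases O.mem_or_inv_mem y with hy | hy
  · exact hy
  · rcases eq_or_ne y 0 with rfl | hy0
    · exact O.zero_mem
    · have := O.mul_mem _ _ h hy
      rwa [pow_two, mul_assoc, mul_inv_cancel₀ hy0, mul_one] at this

/-- If `y ^ 2 = F(x)` with `F` separable, then `dx / y` is regular at the places at which `x` is. -/
theorem isRegularAt_smul_inv_smul_D (hy0 : y ≠ 0) (hy : y ^ 2 = aeval x F) (hF : F.Separable)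
    (O : ValuationSubring K) (hO : ∀ c : k, algebraMap k K c ∈ O) (hx : x ∈ O) {a : K}
    (ha : a ∈ O) : IsRegularAt k K O (a • (y⁻¹ • D k K x)) := by
  have hyO : y ∈ O := O.mem_of_sq_mem (hy ▸ O.aeval_mem hO hx F)
  obtain ⟨b, c, hbc⟩ := hF
  have hbc' := congrArg (aeval x) hbc
  simp only [map_add, map_mul, map_one, ← hy] at hbc'
  have h2y : (2 * y) • D k K y = aeval x (derivative F) • D k K x := by
    have h := congrArg (D k K) hy
    rw [Derivation.leibniz_pow, Derivation.map_aeval] at h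
    simpa [mul_smul, ofNat_smul_eq_nsmul] using h
  -- With `b F + c F' = 1` and `2y dy = F' dx`, one has `dx/y = b y dx + 2c dy`, free of
  -- denominators.
  have key : a • (y⁻¹ • D k K x) =
      (a * (aeval x b * y)) • D k K x + (a * (aeval x c * 2)) • D k K y := by
    have : (aeval x c * 2) • D k K y = (aeval x c * y⁻¹ * aeval x (derivative F)) • D k K x := by
      rw [mul_smul _ (aeval x (derivative F)), ← h2y, smul_smul]
      congr 1
      field_simp
    rw [mul_smul a, mul_smul a, this, ← smul_add, ← add_smul]
    congr 2
    field_simp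
    linear_combination -hbc'
  rw [key]
  have h2 : (2 : K) ∈ O := by
    rw [← one_add_one_eq_two]
    exact O.add_mem _ _ O.one_mem O.one_mem
  exact AddSubgroup.add_mem _
    (AddSubgroup.subset_closure ⟨_, O.mul_mem _ _ ha (O.mul_mem _ _ (O.aeval_mem hO hx b) hyO),
      x, hx, rfl⟩)
    (AddSubgroup.subset_closure ⟨_, O.mul_mem _ _ ha (O.mul_mem _ _ (O.aeval_mem hO hx c) h2),
      y, hyO, rfl⟩)

end Regular

/-! ### The chart at infinity and the space of holomorphic differentials -/

section Infinity

variable {k K : Type*} [Field k] [Field K] [Algebra k K] {x y : K}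

theorem separable_X_pow_add_one {m : ℕ} (hm : (m : k) ≠ 0) : (X ^ m + 1 : k[X]).Separable := by
  have := separable_X_pow_sub_C (-1 : k) hm (by simp)
  simpa using this

theorem separable_X_pow_mul_X_pow_add_one {m e : ℕ} (hm : (m : k) ≠ 0) (he : e ≤ 1) :
    (X ^ e * (X ^ m + 1) : k[X]).Separable := by
  have hm0 : m ≠ 0 := by rintro rfl; simp at hm
  interval_cases e
  · simpa using separable_X_pow_add_one hm
  · rw [pow_one]
    refine separable_X.mul (separable_X_pow_add_one hm) ⟨-X ^ (m - 1), 1, ?_⟩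
    rw [neg_mul, ← pow_succ, Nat.sub_add_cancel (Nat.pos_of_ne_zero hm0)]
    ring

namespace IsFunctionFieldOfSqEq

theorem x_ne_zero {F : k[X]} (hK : IsFunctionFieldOfSqEq F x y) : x ≠ 0 := by
  rintro rfl
  exact hK.transcendental isAlgebraic_zero

/-- The chart at infinity: `u = 1 / x`, `v = y / x ^ n` with `m ≤ 2 n`. -/
theorem inv {m n e : ℕ} (hn : m + e = 2 * n)
    (hK : IsFunctionFieldOfSqEq (X ^ m + 1 : k[X]) x y) :
    IsFunctionFieldOfSqEq (X ^ e * (X ^ m + 1) : k[X]) x⁻¹ (y * x⁻¹ ^ n) := by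
  have hx0 := hK.x_ne_zero
  refine ⟨fun h => hK.transcendental (by simpa using h.inv), ?_, ?_⟩
  · have h := hK.equation
    simp only [map_add, map_mul, map_pow, aeval_X, map_one] at h ⊢
    rw [mul_pow, h, ← pow_mul, mul_comm n 2, ← hn, pow_add]
    have : x ^ m * x⁻¹ ^ m = 1 := by rw [← mul_pow, mul_inv_cancel₀ hx0, one_pow]
    linear_combination (x⁻¹ ^ e) * this
  · rw [eq_top_iff, ← hK.adjoin_eq_top, IntermediateField.adjoin_le_iff]
    have hx : x ∈ IntermediateField.adjoin k {x⁻¹, y * x⁻¹ ^ n} := by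
      have : x⁻¹ ∈ IntermediateField.adjoin k {x⁻¹, y * x⁻¹ ^ n} :=
        IntermediateField.subset_adjoin _ _ (by simp)
      simpa using inv_mem this
    have hv : y * x⁻¹ ^ n ∈ IntermediateField.adjoin k {x⁻¹, y * x⁻¹ ^ n} :=
        IntermediateField.subset_adjoin _ _ (by simp)
    rintro _ (rfl | rfl)
    · exact hx
    · have := mul_mem hv (pow_mem hx n)
      rwa [mul_assoc, ← mul_pow, inv_mul_cancel₀ hx0, one_pow, mul_one] at this

end IsFunctionFieldOfSqEq

/-- The transition factor between the charts, `dx/y = -u ^ (n-2) du/v` when `n ≥ 2`, is the source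
of the degree bound. -/
theorem inv_smul_D_eq (hx0 : x ≠ 0) (n : ℕ) :
    y⁻¹ • D k K x = (-(x⁻¹ ^ n * x ^ 2)) • ((y * x⁻¹ ^ n)⁻¹ • D k K x⁻¹) := by
  rw [Derivation.leibniz_inv, smul_smul, smul_smul]
  congr 1
  field_simp

namespace IsFunctionFieldOfSqEq

variable {m n e : ℕ}

/-- Every valuation ring contains `x` or `1/x`; in the second case the differential is `-u ^ (n-2-i)
du/v`. -/
theorem smul_mem_holomorphicDifferentials (hm : (m : k) ≠ 0) (he : e ≤ 1) (hn : m + e = 2 * n)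
    (hK : IsFunctionFieldOfSqEq (X ^ m + 1 : k[X]) x y) {i : ℕ} (hi : i + 1 < n) :
    x ^ i • (y⁻¹ • D k K x) ∈ holomorphicDifferentials k K := by
  have hx0 := hK.x_ne_zero
  have hsep := separable_X_pow_add_one hm
  have hy0 := hK.y_ne_zero hsep.ne_zero
  intro O hO
  rcases O.mem_or_inv_mem x with hx | hx
  · exact isRegularAt_smul_inv_smul_D hy0 hK.equation hsep O hO hx (O.toSubring.pow_mem hx i)
  · rw [inv_smul_D_eq hx0 n, smul_smul]
    have hv0 : y * x⁻¹ ^ n ≠ 0 := mul_ne_zero hy0 (pow_ne_zero _ (inv_ne_zero hx0))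
    refine isRegularAt_smul_inv_smul_D hv0 (hK.inv hn).equation
      (separable_X_pow_mul_X_pow_add_one hm he) O hO hx ?_
    have : x ^ i * -(x⁻¹ ^ n * x ^ 2) = -(x⁻¹ ^ (n - 2 - i)) := by
      obtain ⟨j, rfl⟩ : ∃ j, n = j + i + 2 := ⟨n - 2 - i, by omega⟩
      rw [show j + i + 2 - 2 - i = j by omega, inv_pow, inv_pow]
      field_simp
      ring
    rw [this]
    exact O.neg_mem _ (O.toSubring.pow_mem hx _)

/-- The coefficient `h` is polynomial in `x, y`, while `-h x ^ (2-n)` is polynomial in `1/x` and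
`v`; the two expansions overlap only in low degree. -/
theorem exists_of_smul_mem_holomorphicDifferentials (h2 : (2 : k) ≠ 0) (hm : (m : k) ≠ 0)
    (he : e ≤ 1) (hn : m + e = 2 * n)
    (hK : IsFunctionFieldOfSqEq (X ^ m + 1 : k[X]) x y) {h : K}
    (hh : h • (y⁻¹ • D k K x) ∈ holomorphicDifferentials k K) :
    ∃ P : k[X], (∀ i, P.coeff i ≠ 0 → i + 1 < n) ∧ h = aeval x P := by
  have hm0 : m ≠ 0 := by rintro rfl; simp at hm
  have hx0 := hK.x_ne_zero
  have hsep := separable_X_pow_add_one hm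
  have hsep' := separable_X_pow_mul_X_pow_add_one hm he
  have hdeg : 0 < (X ^ m + 1 : k[X]).natDegree := by
    rw [← C_1, natDegree_X_pow_add_C]; omega
  have hdeg' : 0 < (X ^ e * (X ^ m + 1) : k[X]).natDegree := by
    rw [natDegree_mul (pow_ne_zero _ X_ne_zero) hsep.ne_zero]; omega
  obtain ⟨A, B, hAB⟩ := hK.exists_of_isRegularAt h2 hsep.squarefree hdeg hh
  rw [inv_smul_D_eq hx0 n, smul_smul] at hh
  obtain ⟨A', B', hAB'⟩ := (hK.inv hn).exists_of_isRegularAt h2 hsep'.squarefree hdeg' hh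
  obtain ⟨M, hMA, hMB⟩ : ∃ M, A'.natDegree ≤ M ∧ B'.natDegree ≤ M :=
    ⟨_, le_max_left _ _, le_max_right _ _⟩
  have hrefl : ∀ Q : k[X], Q.natDegree ≤ M → aeval x (reflect M Q) = x ^ M * aeval x⁻¹ Q := by
    intro Q hQ
    let _ := invertibleOfNonzero (inv_ne_zero hx0)
    have := eval₂_reflect_mul_pow (algebraMap k K) x⁻¹ M Q hQ
    rw [invOf_eq_inv, inv_inv] at this
    rw [aeval_def, aeval_def, ← this, inv_pow]
    field_simp
  -- The equality of the two expansions, multiplied by `-x ^ (M+n)` to clear denominators. The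
  -- reflected polynomials have degree at most `M`, so `B = 0` and `A` has degree at most `n - 2`.
  have hzero : aeval x (X ^ (M + 2) * A + X ^ n * reflect M A') +
      aeval x (X ^ (M + 2) * B + reflect M B') * y = 0 := by
    have hxn : x ^ n * x⁻¹ ^ n = 1 := by rw [← mul_pow, mul_inv_cancel₀ hx0, one_pow]
    simp only [map_add, map_mul, map_pow, aeval_X, hrefl _ hMA, hrefl _ hMB]
    rw [hAB] at hAB'
    linear_combination (-x ^ M * x ^ n) * hAB' +
      (- x ^ M * x ^ 2 * (aeval x A + aeval x B * y) - x ^ M * aeval x⁻¹ B' * y) * hxn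
  obtain ⟨h1, h3⟩ := hK.eq_zero_of_add_mul_eq_zero hsep.squarefree hdeg hzero
  have hcoeff : ∀ Q : k[X], Q.natDegree ≤ M → ∀ i, M < i → (reflect M Q).coeff i = 0 := by
    intro Q hQ i hi
    rw [coeff_reflect, revAt_eq_self_of_lt hi, coeff_eq_zero_of_natDegree_lt (by omega)]
  have hB : B = 0 := by
    ext i
    have := congrArg (fun P => coeff P (i + (M + 2))) h3
    simpa [coeff_X_pow_mul, hcoeff _ hMB (i + (M + 2)) (by omega)] using this
  refine ⟨A, fun i hi => ?_, by simpa [hB] using hAB⟩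
  by_contra hlt
  have := congrArg (fun P => coeff P (i + (M + 2))) h1
  simp only [coeff_add, coeff_X_pow_mul, coeff_zero] at this
  rw [show i + (M + 2) = (i + (M + 2) - n) + n by omega, coeff_X_pow_mul,
    hcoeff _ hMA _ (by omega), add_zero] at this
  exact hi this

end IsFunctionFieldOfSqEq

end Infinity

/-! ### `K` over `K ^ p`, the Cartier operator and exactness -/

section FrobeniusBasis

theorem KaehlerDifferential.D_pow_char {k K : Type*} [Field k] [Field K] [Algebra k K] (p : ℕ)
    [CharP K p] (f : K) : D k K (f ^ p) = 0 := by
  rw [Derivation.leibniz_pow, ← Nat.cast_smul_eq_nsmul K, CharP.cast_eq_zero, zero_smul]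

theorem KaehlerDifferential.D_pow_char_mul {k K : Type*} [Field k] [Field K] [Algebra k K]
    (p : ℕ) [CharP K p] (f g : K) : D k K (f ^ p * g) = f ^ p • D k K g := by
  rw [Derivation.leibniz, D_pow_char, smul_zero, add_zero]

theorem KaehlerDifferential.D_sum_pow_mul_pow {k K : Type*} [Field k] [Field K] [Algebra k K]
    (p : ℕ) [CharP K p] (f : ℕ → K) (t : K) (s : Finset ℕ) :
    D k K (∑ i ∈ s, f i ^ p * t ^ i) =
      (∑ i ∈ s, f i ^ p * (i * t ^ (i - 1))) • D k K t := by
  rw [map_sum, Finset.sum_smul]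
  refine Finset.sum_congr rfl fun i _ => ?_
  rw [D_pow_char_mul, Derivation.leibniz_pow, ← Nat.cast_smul_eq_nsmul K, smul_smul, smul_smul,
    mul_assoc]

theorem natCast_ne_zero_of_lt {R : Type*} [AddMonoidWithOne R] (p : ℕ) [CharP R p] {i : ℕ}
    (h0 : 0 < i) (hi : i < p) : (i : R) ≠ 0 := fun h =>
  absurd (Nat.le_of_dvd h0 ((CharP.cast_eq_zero_iff R p i).1 h)) (by omega)

theorem not_exists_eq_pow_of_D_ne_zero {k K : Type*} [Field k] [Field K] [Algebra k K]
    (p : ℕ) [CharP K p] {t : K} (h : D k K t ≠ 0) : ¬ ∃ u : K, t = u ^ p := by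
  rintro ⟨u, rfl⟩
  exact h (D_pow_char p u)

variable {K : Type*} [Field K] (p : ℕ) [Fact p.Prime] [CharP K p] {t : K}

/-- Frobenius is injective, so the only possible `p`-th root of `t ^ p` is `t`, which is not in `K ^
p`. -/
theorem minpoly_frobenius_fieldRange (ht : ¬ ∃ u : K, t = u ^ p) :
    minpoly (frobenius K p).fieldRange t = X ^ p - C (⟨t ^ p, t, rfl⟩ : (frobenius K p).fieldRange) := by
  refine (minpoly.eq_of_irreducible_of_monic (X_pow_sub_C_irreducible_of_prime Fact.out ?_)
    ?_ (monic_X_pow_sub_C _ (Fact.out : p.Prime).ne_zero)).symm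
  · rintro ⟨b, c, hc⟩ hb
    have hb' : b ^ p = t ^ p := congrArg Subtype.val hb
    exact ht ⟨c, by rw [← frobenius_inj K p hb']; exact hc.symm⟩
  · rw [map_sub, map_pow, aeval_X, aeval_C, sub_eq_zero]
    rfl

theorem linearIndependent_pow_frobenius (ht : ¬ ∃ u : K, t = u ^ p) :
    LinearIndependent (frobenius K p).fieldRange fun i : Fin p => t ^ (i : ℕ) := by
  have h := linearIndependent_pow (K := (frobenius K p).fieldRange) t
  have hdeg : (minpoly (frobenius K p).fieldRange t).natDegree = p := by
    rw [minpoly_frobenius_fieldRange p ht, natDegree_X_pow_sub_C]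
  rwa [hdeg] at h

theorem Subfield.eq_zero_of_linearIndependent {K ι : Type*} [Field K] [Fintype ι] (S : Subfield K)
    {v : ι → K} (hv : LinearIndependent S v) {c : ι → K} (hc : ∀ i, c i ∈ S)
    (h : ∑ i, c i * v i = 0) (i : ι) : c i = 0 :=
  congrArg Subtype.val (Fintype.linearIndependent_iff.1 hv (fun i => ⟨c i, hc i⟩)
    ((Finset.sum_congr rfl fun _ _ => Subfield.smul_def _ _).trans h) i)

theorem eq_zero_of_sum_pow_mul_pow_eq_zero (ht : ¬ ∃ u : K, t = u ^ p) {f : ℕ → K}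
    (hf : ∑ i ∈ Finset.range p, f i ^ p * t ^ i = 0) (i : ℕ) (hi : i < p) : f i = 0 := by
  rw [Finset.sum_range] at hf
  exact eq_zero_of_pow_eq_zero (Subfield.eq_zero_of_linearIndependent _
    (linearIndependent_pow_frobenius p ht) (fun i => ⟨f i, frobenius_def p (f i)⟩) hf ⟨i, hi⟩)

theorem exists_eq_sum_pow_mul_pow (hK : Module.finrank (frobenius K p).fieldRange K = p)
    (ht : ¬ ∃ u : K, t = u ^ p) (z : K) :
    ∃ f : ℕ → K, z = ∑ i ∈ Finset.range p, f i ^ p * t ^ i := by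
  have : Nonempty (Fin p) := ⟨⟨0, (Fact.out : p.Prime).pos⟩⟩
  have hspan := (linearIndependent_pow_frobenius p ht).span_eq_top_of_card_eq_finrank
    (by rw [hK, Fintype.card_fin])
  obtain ⟨c, hc⟩ := (Submodule.mem_span_range_iff_exists_fun _).1
    (hspan ▸ Submodule.mem_top : z ∈ _)
  choose g hg using fun i => (c i).2
  refine ⟨fun i => if h : i < p then g ⟨i, h⟩ else 0, ?_⟩
  rw [← hc, Finset.sum_range]
  refine Finset.sum_congr rfl fun i _ => ?_
  have := hg i
  rw [frobenius_def] at this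
  simp only [Fin.is_lt, dite_true, Fin.eta, this]
  rfl

variable {k : Type*} [Field k] [Algebra k K]

/-- Every differential is a multiple of `dt`. -/
theorem exists_eq_smul_D (hK : Module.finrank (frobenius K p).fieldRange K = p)
    (ht : ¬ ∃ u : K, t = u ^ p) (ω : Ω[K⁄k]) : ∃ h : K, ω = h • D k K t := by
  have hω : ω ∈ Submodule.span K (Set.range (D k K)) :=
    span_range_derivation k K ▸ Submodule.mem_top
  have hle : Submodule.span K (Set.range (D k K)) ≤ Submodule.span K {D k K t} := by
    rw [Submodule.span_le]
    rintro _ ⟨z, rfl⟩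
    obtain ⟨f, rfl⟩ := exists_eq_sum_pow_mul_pow p hK ht z
    rw [D_sum_pow_mul_pow]
    exact Submodule.smul_mem _ _ (Submodule.mem_span_singleton_self _)
  obtain ⟨h, hh⟩ := Submodule.mem_span_singleton.1 (hle hω)
  exact ⟨h, hh.symm⟩

variable [IsAlgClosed k] {F : k[X]} {x y : K}

/-- `K = K ^ p (x)`: constants are `p`-th powers, and `y = y ^ p F(x) ^ (-r)` for odd `p = 2r + 1`.
-/
theorem IsFunctionFieldOfSqEq.finrank_frobenius_fieldRange (hK : IsFunctionFieldOfSqEq F x y) (hp : p ≠ 2) (hF : F ≠ 0)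
    (hx : ¬ ∃ u : K, x = u ^ p) : Module.finrank (frobenius K p).fieldRange K = p := by
  have hp0 := (Fact.out : p.Prime).ne_zero
  have hint : IsIntegral (frobenius K p).fieldRange x := by
    by_contra h
    have := minpoly_frobenius_fieldRange p hx
    rw [minpoly.eq_zero h] at this
    exact (monic_X_pow_sub_C _ hp0).ne_zero this.symm
  have hpow : ∀ z : K, z ^ p ∈ IntermediateField.adjoin (frobenius K p).fieldRange {x} :=
    fun z => IntermediateField.algebraMap_mem _ (⟨z ^ p, z, rfl⟩ : (frobenius K p).fieldRange)
  have hconst : ∀ c : k, algebraMap k K c ∈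
      IntermediateField.adjoin (frobenius K p).fieldRange {x} := fun c => by
    obtain ⟨b, rfl⟩ := IsAlgClosed.exists_pow_nat_eq c (Fact.out : p.Prime).pos
    rw [map_pow]
    exact hpow _
  have hx' := IntermediateField.mem_adjoin_simple_self (frobenius K p).fieldRange x
  have htop : IntermediateField.adjoin (frobenius K p).fieldRange {x} = ⊤ := by
    rw [eq_top_iff]
    intro z _
    have hz : z ∈ IntermediateField.adjoin k {x, y} := hK.adjoin_eq_top ▸ IntermediateField.mem_top
    induction hz using IntermediateField.adjoin_induction with
    | mem z hz =>
      rcases hz with rfl | rfl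
      · exact hx'
      · obtain ⟨r, hr⟩ := (Fact.out : p.Prime).odd_of_ne_two hp
        have hFx : aeval x F ∈ IntermediateField.adjoin (frobenius K p).fieldRange {x} := by
          rw [aeval_eq_sum_range]
          refine sum_mem fun i _ => ?_
          rw [Algebra.smul_def]
          exact mul_mem (hconst _) (pow_mem hx' i)
        have hz0 := hK.y_ne_zero hF
        have hzp : z = z ^ p * (aeval x F ^ r)⁻¹ := by
          rw [← hK.equation, ← pow_mul, eq_mul_inv_iff_mul_eq₀ (pow_ne_zero _ hz0), hr]
          ring
        rw [hzp]
        exact mul_mem (hpow z) (inv_mem (pow_mem hFx r))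
    | algebraMap c => exact hconst c
    | add z w _ _ h1 h2 => exact add_mem (h1 trivial) (h2 trivial)
    | inv z _ h => exact inv_mem (h trivial)
    | mul z w _ _ h1 h2 => exact mul_mem (h1 trivial) (h2 trivial)
  rw [← IntermediateField.finrank_top', ← htop, IntermediateField.adjoin.finrank hint,
    minpoly_frobenius_fieldRange p hx, natDegree_X_pow_sub_C]

variable [CharP k p]

/-- The Cartier operator vanishes exactly on the exact differentials. -/
theorem cartierEq_zero_iff (hK : Module.finrank (frobenius K p).fieldRange K = p)
    (ht : ¬ ∃ u : K, t = u ^ p) (hDt : D k K t ≠ 0) (ω : Ω[K⁄k]) :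
    CartierEq k p t ω 0 ↔ ω ∈ LinearMap.range (D k K).toLinearMap := by
  obtain ⟨q, rfl⟩ : ∃ q, p = q + 1 := ⟨p - 1, by have := (Fact.out : p.Prime).pos; omega⟩
  constructor
  · rintro ⟨f, rfl, hf⟩
    have hf0 : f q = 0 := by simpa [hDt] using hf.symm
    -- Integrating `t ^ i` divides by `i + 1`; a `p`-th root of this constant is absorbed into the
    -- coefficient `f i`.
    choose c hc using fun i : ℕ => IsAlgClosed.exists_pow_nat_eq ((i + 1 : ℕ) : k)⁻¹ q.succ_pos
    let g : ℕ → K := fun i => algebraMap k K (c (i - 1)) * f (i - 1)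
    refine ⟨∑ i ∈ Finset.Ico 1 (q + 1), g i ^ (q + 1) * t ^ i, ?_⟩
    change D k K _ = _
    rw [D_sum_pow_mul_pow, Finset.sum_Ico_eq_sum_range, Finset.sum_range_succ, hf0,
      zero_pow q.succ_ne_zero, zero_mul, add_zero]
    congr 1
    refine Finset.sum_congr rfl fun i hi => ?_
    have hi0 : ((i + 1 : ℕ) : k) ≠ 0 :=
      natCast_ne_zero_of_lt (q + 1) i.succ_pos (by simpa using hi)
    have hi0' : ((i + 1 : ℕ) : K) ≠ 0 :=
      natCast_ne_zero_of_lt (q + 1) i.succ_pos (by simpa using hi)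
    simp only [g, add_comm 1 i, Nat.add_sub_cancel]
    rw [mul_pow, ← map_pow, hc, map_inv₀, map_natCast]
    field_simp
  · rintro ⟨h, rfl⟩
    obtain ⟨f, rfl⟩ := exists_eq_sum_pow_mul_pow (q + 1) hK ht h
    choose c hc using fun i : ℕ => IsAlgClosed.exists_pow_nat_eq ((i + 1 : ℕ) : k) q.succ_pos
    refine ⟨fun i => if i < q then algebraMap k K (c i) * f (i + 1) else 0, ?_, by simp⟩
    change D k K _ = _
    rw [D_sum_pow_mul_pow, Finset.sum_range_succ', Finset.sum_range_succ]
    congr 1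
    simp only [lt_irrefl, if_false, Nat.cast_zero, zero_mul, mul_zero, add_zero,
      zero_pow q.succ_ne_zero]
    refine Finset.sum_congr rfl fun i hi => ?_
    rw [if_pos (by simpa using hi), mul_pow, ← map_pow, hc, map_natCast, Nat.add_sub_cancel]
    ring

/-- If `Q(x) dx` is exact then the coefficients of `Q` at the exponents `≡ -1` mod `p` vanish. -/
theorem coeff_eq_zero_of_smul_D_mem_range
    (hK : Module.finrank (frobenius K p).fieldRange K = p) (htr : Transcendental k t)
    (ht : ¬ ∃ u : K, t = u ^ p) (hDt : D k K t ≠ 0) {Q : k[X]}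
    (hQ : aeval t Q • D k K t ∈ LinearMap.range (D k K).toLinearMap) {N : ℕ}
    (hN : N % p = p - 1) : Q.coeff N = 0 := by
  have hp0 := (Fact.out : p.Prime).pos
  obtain ⟨f, hf, hf0⟩ := (cartierEq_zero_iff p hK ht hDt _).2 hQ
  replace hf := smul_left_injective K hDt hf
  have hf0 : f (p - 1) = 0 := by simpa [hDt] using hf0.symm
  choose b hb using fun c : k => IsAlgClosed.exists_pow_nat_eq c hp0
  -- `G i` collects the exponents `≡ i` mod `p`, with `p`-th roots of the coefficients, so that `Q =
  -- ∑ G i ^ p X ^ i` is the `K ^ p`-expansion of `Q(t)`; uniqueness of the expansion then forces `G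
  -- (p - 1) = 0`.
  let G : ℕ → k[X] := fun i => ∑ N ∈ Q.support with N % p = i, monomial (N / p) (b (Q.coeff N))
  have hG : aeval t Q = ∑ i ∈ Finset.range p, aeval t (G i) ^ p * t ^ i := by
    rw [aeval_def, eval₂_eq_sum, Polynomial.sum, ← Finset.sum_fiberwise_of_maps_to (s := Q.support) (t := Finset.range p)
        (g := fun N => N % p) (fun N _ => Finset.mem_range.2 (Nat.mod_lt _ hp0))]
    refine Finset.sum_congr rfl fun i _ => ?_
    rw [map_sum, sum_pow_char, Finset.sum_mul]
    refine Finset.sum_congr rfl fun N hN => ?_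
    rw [aeval_monomial, mul_pow, ← map_pow, hb, mul_assoc, ← pow_mul]
    congr 1
    rw [← (Finset.mem_filter.1 hN).2, ← pow_add, mul_comm, Nat.div_add_mod]
  have hsub : ∑ i ∈ Finset.range p, (aeval t (G i) - f i) ^ p * t ^ i = 0 := by
    simp only [sub_pow_char, sub_mul, Finset.sum_sub_distrib]
    rw [← hG, ← hf, sub_self]
  have h := eq_zero_of_sum_pow_mul_pow_eq_zero p ht hsub (p - 1) (by omega)
  rw [hf0, sub_zero] at h
  have hG0 : G (p - 1) = 0 := by
    by_contra hne
    exact htr ⟨_, hne, h⟩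
  by_contra hne
  have hc := congrArg (fun P => coeff P (N / p)) hG0
  simp only [G, finsetSum_coeff, coeff_monomial, coeff_zero] at hc
  rw [Finset.sum_eq_single N] at hc
  · rw [if_pos rfl] at hc
    exact hne (by rw [← hb (Q.coeff N), hc, zero_pow hp0.ne'])
  · intro M hM hMN
    refine if_neg fun h => hMN ?_
    rw [← Nat.div_add_mod M p, ← Nat.div_add_mod N p, h, (Finset.mem_filter.1 hM).2, hN]
  · intro h
    exact absurd (Finset.mem_filter.2 ⟨mem_support_iff.2 hne, hN⟩) h

end FrobeniusBasis

/-! ### Exactness of monomial differentials and the count -/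

section ANumber

theorem card_filter_range_mod_lt {p r : ℕ} (hr : r ≤ p) (j a : ℕ) (ha : a ≤ p) :
    ((Finset.range (j * p + a)).filter (fun i => i % p < r)).card = j * r + min a r := by
  have hblock : ∀ b q : ℕ, b ≤ p →
      ∑ i ∈ Finset.range b, (if (q * p + i) % p < r then 1 else 0) = min b r := by
    intro b q hb
    rw [← Finset.card_filter, ← Finset.card_range (min b r)]
    congr 1
    ext i
    simp only [Finset.mem_filter, Finset.mem_range, lt_min_iff]
    refine and_congr_right fun hi => ?_
    rw [mul_comm, Nat.mul_add_mod, Nat.mod_eq_of_lt (by omega)]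
  rw [Finset.card_filter, Finset.sum_range_add, hblock a j ha]
  congr 1
  induction j with
  | zero => simp
  | succ j ih =>
    rw [add_mul, one_mul, Finset.sum_range_add, ih, hblock p j le_rfl, min_eq_right hr]
    ring

theorem natCast_choose_ne_zero {k : Type*} [Field k] {p : ℕ} [hp : Fact p.Prime] [CharP k p]
    {r c : ℕ} (hr : r < p) (hc : c ≤ r) : (r.choose c : k) ≠ 0 := by
  rw [Ne, CharP.cast_eq_zero_iff k p]
  intro h
  have h1 : p ∣ r.factorial := by
    rw [← Nat.choose_mul_factorial_mul_factorial hc, mul_assoc]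
    exact h.mul_right _
  exact absurd ((hp.out.dvd_factorial).1 h1) (by omega)

theorem X_pow_add_one_pow {k : Type*} [Field k] (m r : ℕ) : ((X ^ m + 1) ^ r : k[X]) =
    ∑ c ∈ Finset.range (r + 1), C (r.choose c : k) * X ^ (m * c) := by
  rw [add_pow]
  refine Finset.sum_congr rfl fun c _ => ?_
  rw [one_pow, mul_one, ← pow_mul, mul_comm, map_natCast]

namespace IsFunctionFieldOfSqEq

/-- This trades `y⁻¹` for a `p`-th power, invisible to `D`, times a polynomial in `x`. -/
theorem inv_pow_mul_pow_eq {k K : Type*} [Field k] [Field K] [Algebra k K] {p r m : ℕ}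
    {x y : K} (hp : p = 2 * r + 1)
    (hK : IsFunctionFieldOfSqEq (X ^ m + 1 : k[X]) x y) (hy0 : y ≠ 0) :
    (y⁻¹) ^ p * aeval x ((X ^ m + 1 : k[X]) ^ r) = y⁻¹ := by
  rw [map_pow, ← hK.equation, hp, inv_pow]
  field_simp
  ring

variable {k K : Type*} [Field k] [Field K] [Algebra k K]
  {p : ℕ} [CharP k p] {r s m g e : ℕ} {x y : K}

/-- Termwise integration divides by `i + m c + 1 ≡ i % p + c + 1` mod `p`, which lies between `1`
and `2r < p`. -/
theorem smul_mem_range_D (hp : p = 2 * r + 1) (hm : m = s * p + 1)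
    (hK : IsFunctionFieldOfSqEq (X ^ m + 1 : k[X]) x y) (hy0 : y ≠ 0) {i : ℕ} (hi : i % p < r) :
    x ^ i • (y⁻¹ • D k K x) ∈ LinearMap.range (D k K).toLinearMap := by
  have : CharP K p := charP_of_injective_algebraMap (algebraMap k K).injective p
  let H : k[X] := ∑ c ∈ Finset.range (r + 1),
    C ((r.choose c : k) * ((i + m * c + 1 : ℕ) : k)⁻¹) * X ^ (i + m * c + 1)
  have hH : derivative H = X ^ i * (X ^ m + 1) ^ r := by
    rw [X_pow_add_one_pow, Finset.mul_sum, derivative_sum]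
    refine Finset.sum_congr rfl fun c hc => ?_
    have hne : ((i + m * c + 1 : ℕ) : k) ≠ 0 := by
      rw [Ne, CharP.cast_eq_zero_iff k p, hm]
      intro h
      have hc' : c ≤ r := Nat.lt_succ_iff.1 (Finset.mem_range.1 hc)
      rw [← Nat.div_add_mod i p, show p * (i / p) + i % p + (s * p + 1) * c + 1 =
        p * (i / p + s * c) + (i % p + c + 1) by ring,
        Nat.dvd_add_right (dvd_mul_right _ _)] at h
      exact absurd (Nat.le_of_dvd (by omega) h) (by omega)
    rw [derivative_C_mul, derivative_X_pow, ← mul_assoc, ← C_mul,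
      inv_mul_cancel_right₀ hne, Nat.add_sub_cancel, pow_add]
    ring
  refine ⟨(y⁻¹) ^ p * aeval x H, ?_⟩
  change D k K _ = _
  rw [D_pow_char_mul, Derivation.map_aeval, hH, smul_smul, smul_smul, map_mul, map_pow, aeval_X]
  congr 1
  linear_combination x ^ i * inv_pow_mul_pow_eq hp hK hy0

variable [Fact p.Prime] [IsAlgClosed k]

/-- If `i % p ≥ r`, some exponent `i + m c` with `c ≤ r` is `≡ -1` mod `p`, and its coefficient is a
nonzero binomial coefficient times `P.coeff i`, contradicting exactness. -/
theorem mod_lt_of_coeff_ne_zero (hp : p = 2 * r + 1) (hm : m = s * p + 1) (hgm : g < m)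
    (hK : IsFunctionFieldOfSqEq (X ^ m + 1 : k[X]) x y) (hy0 : y ≠ 0) (hDx : D k K x ≠ 0)
    {P : k[X]} (hP : ∀ i, P.coeff i ≠ 0 → i < g)
    (hex : aeval x P • (y⁻¹ • D k K x) ∈ LinearMap.range (D k K).toLinearMap) {i : ℕ}
    (hi : P.coeff i ≠ 0) : i % p < r := by
  have : CharP K p := charP_of_injective_algebraMap (algebraMap k K).injective p
  have hx := not_exists_eq_pow_of_D_ne_zero p hDx
  have hfin := hK.finrank_frobenius_fieldRange p (by omega)
    (by rintro h; have := hK.equation; rw [h, map_zero] at this; simp_all) hx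
  have hex' : aeval x (P * (X ^ m + 1) ^ r) • D k K x ∈ LinearMap.range (D k K).toLinearMap := by
    obtain ⟨w, hw⟩ := hex
    replace hw : D k K w = _ := hw
    refine ⟨y ^ p * w, ?_⟩
    change D k K _ = _
    rw [D_pow_char_mul, hw, smul_smul, smul_smul, map_mul]
    congr 1
    rw [← inv_pow_mul_pow_eq hp hK hy0, inv_pow]
    field_simp
  by_contra hlt
  have hip : i % p < p := Nat.mod_lt _ (by omega)
  obtain ⟨c, hc⟩ : ∃ c, i % p + c = p - 1 := ⟨p - 1 - i % p, by omega⟩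
  have hcoeff := coeff_eq_zero_of_smul_D_mem_range p hfin hK.transcendental hx hDx hex'
    (N := i + m * c) (by
      rw [hm, ← Nat.div_add_mod i p, show p * (i / p) + i % p + (s * p + 1) * c =
        p * (i / p + s * c) + (i % p + c) by ring, hc, Nat.mul_add_mod,
        Nat.mod_eq_of_lt (by omega)])
  have hgi := hP i hi
  -- No other `b` contributes: `i + m c = i' + m b` with `i, i' < g < m` forces `b = c`.
  rw [X_pow_add_one_pow, Finset.mul_sum, finsetSum_coeff, Finset.sum_eq_single c] at hcoeff
  · rw [mul_left_comm, coeff_C_mul, coeff_mul_X_pow] at hcoeff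
    exact mul_ne_zero (natCast_choose_ne_zero (p := p) (by omega) (by omega)) hi hcoeff
  · intro b _ hbc
    rw [mul_left_comm, coeff_C_mul, coeff_mul_X_pow']
    split_ifs with hle
    · refine mul_eq_zero_of_right _ (by_contra fun h => ?_)
      have hlt' := hP _ h
      rcases lt_or_gt_of_ne hbc with hlt | hgt
      · have := Nat.mul_le_mul_left m (Nat.succ_le_of_lt hlt)
        rw [Nat.mul_succ] at this
        omega
      · have := Nat.mul_le_mul_left m (Nat.succ_le_of_lt hgt)
        rw [Nat.mul_succ] at this
        omega
    · rw [mul_zero]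
  · intro h
    exact absurd (Finset.mem_range.2 (by omega)) h

/-- Here `g` is the genus and `e` the parity of `m`; the chart at infinity is used with `n = g + 1`.
-/
theorem exactHolomorphicDifferentials_eq_span (hp : p = 2 * r + 1) (hm : m = s * p + 1)
    (he : e ≤ 1) (hg : m + e = 2 * (g + 1))
    (hK : IsFunctionFieldOfSqEq (X ^ m + 1 : k[X]) x y) (hy0 : y ≠ 0) (hDx : D k K x ≠ 0) :
    exactHolomorphicDifferentials k K = Submodule.span k (Set.range
      fun i : (Finset.range g).filter (fun i => i % p < r) => x ^ (i : ℕ) • (y⁻¹ • D k K x)) := by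
  have hm1 : (m : k) ≠ 0 := by simp [hm]
  have hp0 := (Fact.out : p.Prime).two_le
  have h2 : (2 : k) ≠ 0 := by
    exact_mod_cast natCast_ne_zero_of_lt (R := k) p (i := 2) (by omega) (by omega)
  have : CharP K p := charP_of_injective_algebraMap (algebraMap k K).injective p
  apply le_antisymm
  · rintro ω ⟨hω, hex⟩
    have hx := not_exists_eq_pow_of_D_ne_zero p hDx
    have hfin := hK.finrank_frobenius_fieldRange p (by omega)
      (separable_X_pow_add_one hm1).ne_zero hx
    obtain ⟨h, rfl⟩ := exists_eq_smul_D p hfin hx ω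
    have hh : h • D k K x = (h * y) • (y⁻¹ • D k K x) := by
      rw [smul_smul, mul_inv_cancel_right₀ hy0]
    rw [hh] at hω hex ⊢
    obtain ⟨P, hP, hPh⟩ := hK.exists_of_smul_mem_holomorphicDifferentials h2 hm1 he hg hω
    rw [hPh] at hex ⊢
    have hP' : ∀ i, P.coeff i ≠ 0 → i < g := fun i hi => by have := hP i hi; omega
    rw [aeval_def, eval₂_eq_sum, Polynomial.sum, Finset.sum_smul]
    refine Submodule.sum_mem _ fun i hi => ?_
    rw [mul_smul, algebraMap_smul]
    have hi := mem_support_iff.1 hi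
    exact Submodule.smul_mem _ _ (Submodule.subset_span ⟨⟨i, Finset.mem_filter.2
      ⟨Finset.mem_range.2 (hP' i hi),
        hK.mod_lt_of_coeff_ne_zero hp hm (by omega) hy0 hDx hP' hex hi⟩⟩, rfl⟩)
  · rw [Submodule.span_le]
    rintro _ ⟨⟨i, hi⟩, rfl⟩
    obtain ⟨hig, hir⟩ := Finset.mem_filter.1 hi
    rw [Finset.mem_range] at hig
    exact ⟨hK.smul_mem_holomorphicDifferentials hm1 he hg (Nat.succ_lt_succ hig),
      hK.smul_mem_range_D hp hm hy0 hir⟩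

theorem aNumber_eq_card (hp : p = 2 * r + 1) (hm : m = s * p + 1)
    (he : e ≤ 1) (hg : m + e = 2 * (g + 1))
    (hK : IsFunctionFieldOfSqEq (X ^ m + 1 : k[X]) x y) (hy0 : y ≠ 0) (hDx : D k K x ≠ 0) :
    aNumber k K = ((Finset.range g).filter (fun i => i % p < r)).card := by
  rw [aNumber, hK.exactHolomorphicDifferentials_eq_span hp hm he hg hy0 hDx,
    finrank_span_eq_card, Fintype.card_coe]
  have hη : y⁻¹ • D k K x ≠ 0 := smul_ne_zero (inv_ne_zero hy0) hDx
  -- Powers of the transcendental `x` are independent, and `h ↦ h • η` is injective.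
  have h1 := (basisMonomials k).linearIndependent.map' (aeval x).toLinearMap
    (LinearMap.ker_eq_bot.2 (transcendental_iff_injective.1 hK.transcendental))
  have h1' : LinearIndependent k fun i : ℕ => x ^ i := by
    have hfun : (fun i : ℕ => x ^ i) = (aeval x).toLinearMap ∘ basisMonomials k := by
      ext i
      simp
    rw [hfun]
    exact h1
  have h2 := h1'.map' ((LinearMap.toSpanSingleton K _ (y⁻¹ • D k K x)).restrictScalars k)
    (LinearMap.ker_eq_bot.2 (smul_left_injective K hη))
  exact h2.comp _ Subtype.val_injective

end IsFunctionFieldOfSqEq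

end ANumber

/-! ### The two parities of `s`, and independence of the separating variable -/

theorem theorem3p1 {k K : Type*} [Field k] [IsAlgClosed k] [Field K] [Algebra k K]
    (p : ℕ) [Fact p.Prime] [CharP k p] (hp : 2 < p) (s m : ℕ) (hm : m = s * p + 1)
    (x y : K) (hK : IsFunctionFieldOfSqEq (X ^ m + 1 : k[X]) x y) :
    (∀ j : ℕ, s = 2 * j + 1 → (aNumber k K : ℚ) = ((j : ℚ) + 1) * ((p : ℚ) - 1) / 2) ∧
    (∀ j : ℕ, 1 ≤ j → s = 2 * j → (aNumber k K : ℚ) = (j : ℚ) * ((p : ℚ) - 1) / 2) ∧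
    -- the same number is the dimension of the kernel of the Cartier operator on the space of
    -- holomorphic differentials, whichever separating variable it is computed with
    (∀ t : K, (¬ ∃ u : K, t = u ^ p) →
      Module.finrank k (cartierKernel k p t) = aNumber k K) := by
  have : CharP K p := charP_of_injective_algebraMap (algebraMap k K).injective p
  have hm1 : (m : k) ≠ 0 := by simp [hm]
  have h2 : (2 : k) ≠ 0 := by
    exact_mod_cast natCast_ne_zero_of_lt (R := k) p (i := 2) two_pos hp
  have hsep := separable_X_pow_add_one hm1
  have hy0 := hK.y_ne_zero hsep.ne_zero
  have hDx := hK.D_ne_zero h2 hsep.squarefree (by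
    rw [← C_1, natDegree_X_pow_add_C]; omega)
  have hx := not_exists_eq_pow_of_D_ne_zero p hDx
  have hfin := hK.finrank_frobenius_fieldRange p (by omega) hsep.ne_zero hx
  obtain ⟨r, hr⟩ := (Fact.out : p.Prime).odd_of_ne_two (by omega)
  have hrp : ((p : ℚ) - 1) / 2 = r := by rw [hr]; push_cast; ring
  refine ⟨?_, ?_, ?_⟩
  · rintro j rfl
    -- `m` is even and `g = j p + r`: the last, partial block of residues contributes a further `r`.
    rw [hK.aNumber_eq_card hr hm (e := 0) (g := j * p + r) (by omega)
      (by rw [hm, hr]; ring) hy0 hDx,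
      card_filter_range_mod_lt (by omega) j r (by omega), min_self, mul_div_assoc, hrp]
    push_cast
    ring
  · rintro j - rfl
    -- `m` is odd and `g = j p`: there are only full blocks.
    rw [hK.aNumber_eq_card hr hm (e := 1) (g := j * p + 0) (by omega)
      (by rw [hm]; ring) hy0 hDx,
      card_filter_range_mod_lt (by omega) j 0 (by omega), Nat.zero_min, mul_div_assoc, hrp]
    push_cast
    ring
  · intro t ht
    -- Every differential, in particular `dx ≠ 0`, is a multiple of `dt`.
    have hDt : D k K t ≠ 0 := by
      intro h
      obtain ⟨c, hc⟩ := exists_eq_smul_D p hfin ht (D k K x)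
      exact hDx (by rw [hc, h, smul_zero])
    have heq : cartierKernel k p t = exactHolomorphicDifferentials k K := by
      ext ω
      exact and_congr_right fun _ => cartierEq_zero_iff p hfin ht hDt ω
    rw [heq, aNumber]
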